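/- Let $\mathbb{Z}_-=\{0,-1,-2,\dots\}$ and $\mathcal{X}=\{-1,+1\}^{\mathbb{Z}_-}$, with its product $\sigma$-algebra $\mathcal{B}$ and the shift $T:\mathcal{X}\to\mathcal{X}$, $(Tx)_i=x_{i-1}$. Let $\epsilon=1/4$ and, for $j\ge 1$, $\lambda_j=\frac12\left(\frac23\right)^j$. Let $c$ be an odd integer with $c\ge 577$, let $m_1=217$ and, for $j\ge 1$, $m_{j+1}=c^{m_j}$. The associated Bramson–Kalikow model is the function $p:\mathcal{X}\to[0,1]$, $$p(x)=\sum_{j=1}^{\infty}\lambda_j\,p_{[m_j]}(x),\qquad p_{[m]}(x)=(1-\epsilon)\,\mathbf 1\Big\{x_0\sum_{l=1}^{m}x_{-l}>0\Big\}+\epsilon\,\mathbf 1\Big\{x_0\sum_{l=1}^{m}x_{-l}<0\Big\}.$$ Call a probability measure $\mu$ on $(\mathcal{X},\mathcal{B})$ a stationary measure compatible with $p$ if it is $T$-invariant and, for each $a\in\{-1,+1\}$, $$\mu\big(\{y\in\mathcal{X}: y_0=a\}\,\big|\,T^{-1}\mathcal{B}\big)(x)=p(a\,x_{-1}x_{-2}\cdots)\quad\text{for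 }\mu\text{-almost every }x\in\mathcal{X}.$$ Then the Bramson–Kalikow model has multiple compatible stationary measures: there exist at least two distinct stationary measures compatible with $p$. -/

import Mathlib

open MeasureTheory

/-! Sequences indexed by the non-positive integers with values in an alphabet `A` are represented
as functions `x : ℕ → A`, where `x n` is the coordinate with index `-n`. The `σ`-algebra is the
product one, and the two-letter alphabet `{-1, +1}` is the type `ℤˣ`. -/

/-- The concatenation `a x`: the letter `a` is put at index `0`, in front of the past `x`. -/
def prepend {A : Type*} (a : A) (x : ℕ → A) : ℕ → A
  | 0 => a
  | n + 1 => x n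

/-- The shift operator `(T x)_i = x_{i-1}`, which erases the coordinate of index `0`. -/
def pastShift {A : Type*} (x : ℕ → A) : ℕ → A := fun n => x (n + 1)

/-- `μ` is a (stationary) measure compatible with `g`: it is a shift-invariant probability measure,
and the conditional probability of `{x_0 = a}` given the past `T⁻¹ 𝓑` is `g (a x_{-1} x_{-2} …)`. -/
structure IsGMeasure {A : Type*} [MeasurableSpace A] (g : (ℕ → A) → ℝ)
    (μ : Measure (ℕ → A)) : Prop where
  isProbabilityMeasure : IsProbabilityMeasure μ
  invariant : MeasurePreserving pastShift μ μ
  condExp_eq : ∀ a : A,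
    μ[Set.indicator {x : ℕ → A | x 0 = a} (fun _ => (1 : ℝ)) |
        MeasurableSpace.comap pastShift MeasurableSpace.pi]
      =ᵐ[μ] fun x => g (prepend a (pastShift x))

/-- The kernel `p_[m]`: the letter `x_0` agrees with the majority of the `m` previous letters
with probability `1 - ε`. -/
noncomputable def majorityKernel (ε : ℝ) (m : ℕ) (x : ℕ → ℤˣ) : ℝ :=
  (if 0 < (x 0 : ℤ) * ∑ l ∈ Finset.Icc 1 m, (x l : ℤ) then 1 - ε else 0) +
  (if (x 0 : ℤ) * ∑ l ∈ Finset.Icc 1 m, (x l : ℤ) < 0 then ε else 0)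

/-- The Bramson-Kalikow function `p = ∑_{j ≥ 1} λ_j p_[m_j]`. The values at the index `0` of
`lam` and `m` are not used. -/
noncomputable def bramsonKalikow (ε : ℝ) (lam : ℕ → ℝ) (m : ℕ → ℕ) (x : ℕ → ℤˣ) : ℝ :=
  ∑' j : ℕ, lam (j + 1) * majorityKernel ε (m (j + 1)) x

/-! ### Transfer operators on spin pasts -/

/-! The kernel is `1/2 + a φ(y)/4` with `φ = fullTilt N`, which is odd under the spin flip. It
suffices that the chain started from the all-plus past keeps a mean letter of at least `1/12` at all
times: time averages of its laws then have a compatible limit with that mean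
(`exists_isGMeasure_le_integral`), and the flip gives another with mean at most `-1/12`.

For the mean, consider the chain that keeps the first `K` majorities and replaces all later ones by
`+1`, a bias of total weight `(2/3)^K`. Going from `K` to `K + 1` restores the majority over the
window `N K`, which matters only when the sum over that window is nonpositive. To bound the
probability of this event, set that majority to `-1`. The bias left, `1/3 (2/3)^K`, still forces a
mean of at least half of it (`half_bias_le_transfer_pow`). With `m = N (K - 1)`, this chain has
memory at most `m`, so its oscillations sum to at most `2 m 4^m` (`sum_transferOsc_le`); covariances
are then summable and Chebyshev gives a bound of order `1 / N K` (`transfer_pow_nonposSum_le`).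

The same loss of memory keeps the errors of single steps from accumulating in time
(`transfer_pow_coord_sub_le`). Since `N K = c^m`, restoring majority `K ≥ 1` costs at most
`2^(-K)/12`, out of an initial mean of at least `1/6`. Letting `K → ∞` at fixed time finishes the
bound. -/

/-- The transfer operator of the chain on `{-1, +1}` which, given the past `y`, appends the letter
`±1` with probability `1 / 2 ± φ y / 4`. -/
noncomputable def transfer (φ : (ℕ → ℤˣ) → ℝ) : Module.End ℝ ((ℕ → ℤˣ) → ℝ) where
  toFun f y := (1 / 2 + φ y / 4) * f (prepend 1 y) + (1 / 2 - φ y / 4) * f (prepend (-1) y)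
  map_add' f g := by ext y; simp only [Pi.add_apply]; ring
  map_smul' r f := by ext y; simp only [Pi.smul_apply, smul_eq_mul, RingHom.id_apply]; ring

theorem transfer_apply (φ f : (ℕ → ℤˣ) → ℝ) (y : ℕ → ℤˣ) :
    transfer φ f y =
      (1 / 2 + φ y / 4) * f (prepend 1 y) + (1 / 2 - φ y / 4) * f (prepend (-1) y) := rfl

theorem transfer_pow_succ (φ f : (ℕ → ℤˣ) → ℝ) (t : ℕ) :
    (transfer φ ^ (t + 1)) f = transfer φ ((transfer φ ^ t) f) := by
  rw [pow_succ']; rfl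

theorem transfer_pow_succ' (φ f : (ℕ → ℤˣ) → ℝ) (t : ℕ) :
    (transfer φ ^ (t + 1)) f = (transfer φ ^ t) (transfer φ f) := by
  rw [pow_succ]; rfl

theorem transfer_pow_add (φ f : (ℕ → ℤˣ) → ℝ) (s t : ℕ) :
    (transfer φ ^ (s + t)) f = (transfer φ ^ s) ((transfer φ ^ t) f) := by
  rw [pow_add]; rfl

theorem pastShift_prepend {A : Type*} (a : A) (y : ℕ → A) : pastShift (prepend a y) = y := rfl

theorem prepend_const {A : Type*} (a : A) : prepend a (fun _ => a) = fun _ => a := by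
  funext n; cases n <;> rfl

theorem neg_prepend (a : ℤˣ) (y : ℕ → ℤˣ) : -prepend a y = prepend (-a) (-y) := by
  funext n; cases n <;> rfl

theorem units_neg_one_le (u : ℤˣ) : -1 ≤ u := by
  rcases Int.units_eq_one_or u with rfl | rfl
  · rw [← Units.val_le_val]; norm_num
  · exact le_rfl

theorem units_le_one (u : ℤˣ) : u ≤ 1 := by
  rcases Int.units_eq_one_or u with rfl | rfl
  · exact le_rfl
  · exact units_neg_one_le 1

theorem le_plus (y : ℕ → ℤˣ) : y ≤ 1 := fun n => units_le_one (y n)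

theorem minus_le (y : ℕ → ℤˣ) : -1 ≤ y := fun n => units_neg_one_le (y n)

theorem prepend_mono {a b : ℤˣ} {x y : ℕ → ℤˣ} (hab : a ≤ b) (hxy : x ≤ y) :
    prepend a x ≤ prepend b y := by
  intro n; cases n with
  | zero => exact hab
  | succ n => exact hxy n

theorem prepend_one_one : prepend (1 : ℤˣ) 1 = 1 := prepend_const 1

/-! ### Stochastic order and the spin-flip symmetry -/

section Order

variable {φ ψ : (ℕ → ℤˣ) → ℝ}

theorem transfer_mono (hφ : ∀ y, |φ y| ≤ 1) {f g : (ℕ → ℤˣ) → ℝ} (hfg : f ≤ g) :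
    transfer φ f ≤ transfer φ g := by
  intro y
  have h := abs_le.1 (hφ y)
  rw [transfer_apply, transfer_apply]
  have h1 := mul_le_mul_of_nonneg_left (hfg (prepend 1 y)) (by linarith : 0 ≤ 1 / 2 + φ y / 4)
  have h2 := mul_le_mul_of_nonneg_left (hfg (prepend (-1) y)) (by linarith : 0 ≤ 1 / 2 - φ y / 4)
  exact add_le_add h1 h2

theorem transfer_pow_mono (hφ : ∀ y, |φ y| ≤ 1) {f g : (ℕ → ℤˣ) → ℝ} (hfg : f ≤ g) (t : ℕ) :
    (transfer φ ^ t) f ≤ (transfer φ ^ t) g := by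
  induction t with
  | zero => exact hfg
  | succ t ih => rw [transfer_pow_succ, transfer_pow_succ]; exact transfer_mono hφ ih

theorem transfer_const (φ : (ℕ → ℤˣ) → ℝ) (c : ℝ) :
    transfer φ (fun _ => c) = fun _ => c := by
  ext y; rw [transfer_apply]; ring

theorem transfer_pow_const (φ : (ℕ → ℤˣ) → ℝ) (c : ℝ) (t : ℕ) :
    (transfer φ ^ t) (fun _ => c) = fun _ => c := by
  induction t with
  | zero => rfl
  | succ t ih => rw [transfer_pow_succ, ih, transfer_const]

theorem transfer_pow_smul (φ f : (ℕ → ℤˣ) → ℝ) (c : ℝ) (t : ℕ) (y : ℕ → ℤˣ) :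
    (transfer φ ^ t) (fun x => c * f x) y = c * (transfer φ ^ t) f y := by
  have : (fun x => c * f x) = c • f := rfl
  rw [this, map_smul]; rfl

theorem transfer_le_transfer (hφψ : ψ ≤ φ) {f : (ℕ → ℤˣ) → ℝ} (hf : Monotone f) :
    transfer ψ f ≤ transfer φ f := by
  intro y
  have h := hφψ y
  have h1 : f (prepend (-1) y) ≤ f (prepend 1 y) :=
    hf (prepend_mono (units_le_one _) le_rfl)
  rw [transfer_apply, transfer_apply]
  nlinarith

/-- Attractiveness: a larger past makes the letter `+1` more likely, and `f` gains from that letter.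
-/
theorem monotone_transfer (hφ : ∀ y, |φ y| ≤ 1) (hφm : Monotone φ) {f : (ℕ → ℤˣ) → ℝ}
    (hf : Monotone f) : Monotone (transfer φ f) := by
  intro x y hxy
  have h1 : f (prepend (-1) x) ≤ f (prepend 1 x) :=
    hf (prepend_mono (units_le_one _) le_rfl)
  have h2 : f (prepend 1 x) ≤ f (prepend 1 y) := hf (prepend_mono le_rfl hxy)
  have h3 : f (prepend (-1) x) ≤ f (prepend (-1) y) := hf (prepend_mono le_rfl hxy)
  have h := abs_le.1 (hφ y)
  have h4 := mul_le_mul_of_nonneg_left h2 (by linarith : 0 ≤ 1 / 2 + φ y / 4)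
  have h5 := mul_le_mul_of_nonneg_left h3 (by linarith : 0 ≤ 1 / 2 - φ y / 4)
  have h6 := mul_le_mul_of_nonneg_right (hφm hxy) (sub_nonneg.2 h1)
  rw [transfer_apply, transfer_apply]
  nlinarith

theorem monotone_transfer_pow (hφ : ∀ y, |φ y| ≤ 1) (hφm : Monotone φ) {f : (ℕ → ℤˣ) → ℝ}
    (hf : Monotone f) (t : ℕ) : Monotone ((transfer φ ^ t) f) := by
  induction t with
  | zero => exact hf
  | succ t ih => rw [transfer_pow_succ]; exact monotone_transfer hφ hφm ih

/-- Only the larger tilt has to be monotone: the tilts are exchanged against `(transfer φ ^ t) f`,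
never against iterates of `ψ`. -/
theorem transfer_pow_le_transfer_pow (hψ : ∀ y, |ψ y| ≤ 1) (hφ : ∀ y, |φ y| ≤ 1)
    (hφm : Monotone φ) (hφψ : ψ ≤ φ) {f : (ℕ → ℤˣ) → ℝ} (hf : Monotone f) (t : ℕ) :
    (transfer ψ ^ t) f ≤ (transfer φ ^ t) f := by
  induction t with
  | zero => exact le_rfl
  | succ t ih =>
    rw [transfer_pow_succ, transfer_pow_succ]
    exact (transfer_mono hψ ih).trans (transfer_le_transfer hφψ (monotone_transfer_pow hφ hφm hf t))

theorem transfer_one_le {f : (ℕ → ℤˣ) → ℝ} (hφ : ∀ y, |φ y| ≤ 1) (hf : Monotone f) :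
    transfer φ f 1 ≤ f 1 := by
  have h := abs_le.1 (hφ 1)
  have h1 : f (prepend (-1) 1) ≤ f 1 := hf (le_plus _)
  rw [transfer_apply, prepend_one_one]
  nlinarith

theorem le_transfer_neg_one {f : (ℕ → ℤˣ) → ℝ} (hφ : ∀ y, |φ y| ≤ 1) (hf : Monotone f) :
    f (-1) ≤ transfer φ f (-1) := by
  have h := transfer_mono hφ (f := fun _ => f (-1)) (g := f) (fun y => hf (minus_le y)) (-1)
  rwa [transfer_const] at h

/-- After one step the chain started from the maximal past can only have moved down. -/
theorem transfer_pow_one_antitone (hφ : ∀ y, |φ y| ≤ 1) (hφm : Monotone φ)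
    {f : (ℕ → ℤˣ) → ℝ} (hf : Monotone f) : Antitone fun t => (transfer φ ^ t) f 1 :=
  antitone_nat_of_succ_le fun t => by
    rw [transfer_pow_succ]; exact transfer_one_le hφ (monotone_transfer_pow hφ hφm hf t)

theorem transfer_pow_odd (hφ : ∀ y, φ (-y) = -φ y) {f : (ℕ → ℤˣ) → ℝ}
    (hf : ∀ y, f (-y) = -f y) (t : ℕ) (y : ℕ → ℤˣ) :
    (transfer φ ^ t) f (-y) = -(transfer φ ^ t) f y := by
  induction t generalizing y with
  | zero => exact hf y
  | succ t ih =>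
    have h1 : prepend 1 (-y) = -prepend (-1) y := by rw [neg_prepend, neg_neg]
    have h2 : prepend (-1) (-y) = -prepend 1 y := by rw [neg_prepend]
    rw [transfer_pow_succ, transfer_apply, transfer_apply, h1, h2, ih, ih, hφ]
    ring

theorem transfer_pow_one_nonneg_of_odd (hφ : ∀ y, |φ y| ≤ 1) (hφm : Monotone φ)
    (hφo : ∀ y, φ (-y) = -φ y) {f : (ℕ → ℤˣ) → ℝ} (hf : Monotone f)
    (hfo : ∀ y, f (-y) = -f y) (t : ℕ) : 0 ≤ (transfer φ ^ t) f 1 := by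
  have h1 := transfer_pow_odd hφo hfo t 1
  have h2 := monotone_transfer_pow hφ hφm hf t (minus_le 1)
  linarith

end Order

/-! ### Finite memory and contraction -/

section Contraction

variable {φ : (ℕ → ℤˣ) → ℝ} {m : ℕ}

theorem dependsOn_transfer {f : (ℕ → ℤˣ) → ℝ} (hφ : DependsOn φ (Set.Iio m))
    (hf : DependsOn f (Set.Iio m)) : DependsOn (transfer φ f) (Set.Iio m) := by
  intro x y hxy
  have h (a : ℤˣ) : f (prepend a x) = f (prepend a y) := by
    refine hf fun i hi => ?_
    cases i with
    | zero => rfl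
    | succ i => exact hxy i (lt_of_le_of_lt (Nat.le_succ i) hi)
  rw [transfer_apply, transfer_apply, h, h, hφ hxy]

theorem dependsOn_transfer_pow {f : (ℕ → ℤˣ) → ℝ} (hφ : DependsOn φ (Set.Iio m))
    (hf : DependsOn f (Set.Iio m)) (t : ℕ) :
    DependsOn ((transfer φ ^ t) f) (Set.Iio m) := by
  induction t with
  | zero => exact hf
  | succ t ih => rw [transfer_pow_succ]; exact dependsOn_transfer hφ ih

theorem prepend_iterate_of_lt {A : Type*} (a : A) (y : ℕ → A) {i n : ℕ} (h : i < n) :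
    (prepend a)^[n] y i = a := by
  induction n generalizing i with
  | zero => exact absurd h (Nat.not_lt_zero i)
  | succ n ih =>
    rw [Function.iterate_succ_apply']
    cases i with
    | zero => rfl
    | succ i => exact ih (Nat.lt_of_succ_lt_succ h)

/-- Each `+1` has probability at least `1/4`; keep only the path that appends `t` of them. -/
theorem le_transfer_pow_of_nonneg (hφ : ∀ y, |φ y| ≤ 1) {f : (ℕ → ℤˣ) → ℝ} (hf : 0 ≤ f)
    (t : ℕ) (y : ℕ → ℤˣ) :
    (1 / 4 : ℝ) ^ t * f ((prepend 1)^[t] y) ≤ (transfer φ ^ t) f y := by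
  induction t generalizing y with
  | zero => simp
  | succ t ih =>
    have h0 : 0 ≤ (transfer φ ^ t) f := by
      have := transfer_pow_mono hφ hf t
      rwa [show (0 : (ℕ → ℤˣ) → ℝ) = fun _ => 0 from rfl, transfer_pow_const] at this
    have h := abs_le.1 (hφ y)
    have h1 := ih (prepend 1 y)
    have h2 := h0 (prepend (-1) y)
    have h3 := h0 (prepend 1 y)
    rw [Pi.zero_apply] at h2 h3
    rw [transfer_pow_succ, transfer_apply, Function.iterate_succ_apply, pow_succ]
    nlinarith

/-- The oscillation of `f` at time `t` between the two extremal starting pasts. -/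
noncomputable def transferOsc (φ : (ℕ → ℤˣ) → ℝ) (f : (ℕ → ℤˣ) → ℝ) (t : ℕ) : ℝ :=
  (transfer φ ^ t) f 1 - (transfer φ ^ t) f (-1)

theorem transferOsc_nonneg (hφ : ∀ y, |φ y| ≤ 1) (hφm : Monotone φ) {f : (ℕ → ℤˣ) → ℝ}
    (hf : Monotone f) (t : ℕ) : 0 ≤ transferOsc φ f t :=
  sub_nonneg.2 (monotone_transfer_pow hφ hφm hf t (minus_le 1))

theorem transferOsc_antitone (hφ : ∀ y, |φ y| ≤ 1) (hφm : Monotone φ) {f : (ℕ → ℤˣ) → ℝ}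
    (hf : Monotone f) : Antitone (transferOsc φ f) :=
  antitone_nat_of_succ_le fun t => by
    have h := monotone_transfer_pow hφ hφm hf t
    have h1 := transfer_one_le hφ h
    have h2 := le_transfer_neg_one hφ h
    simp only [transferOsc, transfer_pow_succ]
    linarith

/-- Doeblin's argument: from the all-minus past the next `m` letters are all `+1` with probability
at least `4^(-m)`, after which a function of `m` letters cannot tell this past from the all-plus
one. -/
theorem transferOsc_add_le (hφ : ∀ y, |φ y| ≤ 1) (hφm : Monotone φ)
    (hφd : DependsOn φ (Set.Iio m)) {f : (ℕ → ℤˣ) → ℝ} (hf : Monotone f)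
    (hfd : DependsOn f (Set.Iio m)) (t : ℕ) :
    transferOsc φ f (t + m) ≤ (1 - (1 / 4 : ℝ) ^ m) * transferOsc φ f t := by
  have h1 := transfer_pow_one_antitone hφ hφm hf (Nat.le_add_right t m)
  simp only [transferOsc]
  set h := (transfer φ ^ t) f with hh
  have hmono : Monotone h := monotone_transfer_pow hφ hφm hf t
  have hdep : DependsOn h (Set.Iio m) := dependsOn_transfer_pow hφd hfd t
  have h2 := le_transfer_pow_of_nonneg hφ (f := h - fun _ => h (-1))
    (fun y => sub_nonneg.2 (hmono (minus_le y))) m (-1)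
  rw [map_sub, transfer_pow_const, Pi.sub_apply, Pi.sub_apply,
    hdep (y := 1) (fun i hi => prepend_iterate_of_lt 1 (-1) hi), ← transfer_pow_add,
    Nat.add_comm m t] at h2
  simp only [← hh] at h1
  linarith

theorem sum_transferOsc_le (hφ : ∀ y, |φ y| ≤ 1) (hφm : Monotone φ)
    (hφd : DependsOn φ (Set.Iio m)) {f : (ℕ → ℤˣ) → ℝ} (hf : Monotone f)
    (hfd : DependsOn f (Set.Iio m)) (n : ℕ) :
    ∑ t ∈ Finset.range n, transferOsc φ f t ≤ m * 4 ^ m * transferOsc φ f 0 := by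
  have h0 := transferOsc_nonneg hφ hφm hf
  have h1 : ∑ t ∈ Finset.range n, transferOsc φ f (t + m) ≤
      (1 - (1 / 4 : ℝ) ^ m) * ∑ t ∈ Finset.range n, transferOsc φ f t := by
    rw [Finset.mul_sum]
    exact Finset.sum_le_sum fun t _ => transferOsc_add_le hφ hφm hφd hf hfd t
  -- Splitting off the first `m` terms bounds the sum by itself times `1 - 4^(-m)` plus those terms;
  -- solving for the sum gives the factor `4^m`.
  have h2 : ∑ t ∈ Finset.range n, transferOsc φ f t ≤
      ∑ t ∈ Finset.range m, transferOsc φ f t +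
        ∑ t ∈ Finset.range n, transferOsc φ f (t + m) := by
    have : ∑ t ∈ Finset.range (m + n), transferOsc φ f t =
      ∑ t ∈ Finset.range m, transferOsc φ f t +
        ∑ t ∈ Finset.range n, transferOsc φ f (t + m) := by
      rw [Finset.sum_range_add]; simp only [Nat.add_comm m]
    rw [← this]
    exact Finset.sum_le_sum_of_subset_of_nonneg
      (Finset.range_mono (Nat.le_add_left n m)) fun i _ _ => h0 i
  have h3 : ∑ t ∈ Finset.range m, transferOsc φ f t ≤ m * transferOsc φ f 0 := by
    refine (Finset.sum_le_card_nsmul _ _ (transferOsc φ f 0) fun i _ =>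
      transferOsc_antitone hφ hφm hf (Nat.zero_le i)).trans ?_
    simp
  have h4 : (1 / 4 : ℝ) ^ m * ∑ t ∈ Finset.range n, transferOsc φ f t ≤
      m * transferOsc φ f 0 := by linarith
  have h5 : (4 : ℝ) ^ m * (1 / 4 : ℝ) ^ m = 1 := by rw [← mul_pow]; norm_num
  calc ∑ t ∈ Finset.range n, transferOsc φ f t
      = 4 ^ m * ((1 / 4 : ℝ) ^ m * ∑ t ∈ Finset.range n, transferOsc φ f t) := by
        rw [← mul_assoc, h5, one_mul]
    _ ≤ 4 ^ m * (m * transferOsc φ f 0) := by gcongr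
    _ = m * 4 ^ m * transferOsc φ f 0 := by ring

end Contraction

/-! ### Covariances and concentration of the magnetization -/

/-- The letter at index `-l`, as a real number. -/
def coord (l : ℕ) (y : ℕ → ℤˣ) : ℝ := ((y l : ℤ) : ℝ)

theorem abs_coord (l : ℕ) (y : ℕ → ℤˣ) : |coord l y| = 1 := by
  rcases Int.units_eq_one_or (y l) with h | h <;> simp [coord, h]

theorem coord_mono (l : ℕ) : Monotone (coord l) := fun _ _ h => by
  have := Units.val_le_val.2 (h l)
  simp only [coord]
  exact_mod_cast this

theorem coord_one (l : ℕ) : coord l 1 = 1 := by simp [coord]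

theorem coord_neg (l : ℕ) (y : ℕ → ℤˣ) : coord l (-y) = -coord l y := by simp [coord]

theorem dependsOn_coord_zero {m : ℕ} (hm : 0 < m) : DependsOn (coord 0) (Set.Iio m) :=
  fun x y h => by simp only [coord]; rw [h 0 hm]

theorem coord_comp_iterate_pastShift (l d : ℕ) (y : ℕ → ℤˣ) :
    coord l (pastShift^[d] y) = coord (l + d) y := by
  induction d generalizing y with
  | zero => rfl
  | succ d ih => rw [Function.iterate_succ_apply, ih]; rfl

theorem transferOsc_coord_zero (φ : (ℕ → ℤˣ) → ℝ) : transferOsc φ (coord 0) 0 = 2 := by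
  simp [transferOsc, coord]; norm_num

section Covariance

variable {φ : (ℕ → ℤˣ) → ℝ}

/-- Erasing the `d` letters just appended recovers the starting past, so `v` is a constant factor
for these `d` steps. -/
theorem transfer_pow_mul_comp_pastShift (u v : (ℕ → ℤˣ) → ℝ) (d : ℕ) :
    (transfer φ ^ d) (fun y => u y * v (pastShift^[d] y)) =
      fun y => (transfer φ ^ d) u y * v y := by
  induction d generalizing u v with
  | zero => rfl
  | succ d ih =>
    rw [transfer_pow_succ]
    have h := ih u (fun y => v (pastShift y))
    simp only [← Function.iterate_succ_apply' pastShift] at h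
    rw [h]
    ext y
    rw [transfer_pow_succ, transfer_apply, transfer_apply, pastShift_prepend, pastShift_prepend]
    ring

theorem transfer_pow_comp_pastShift (v : (ℕ → ℤˣ) → ℝ) (d : ℕ) :
    (transfer φ ^ d) (fun y => v (pastShift^[d] y)) = v := by
  have h := transfer_pow_mul_comp_pastShift (φ := φ) (fun _ => 1) v d
  rw [transfer_pow_const] at h
  simpa using h

theorem transfer_pow_coord (l s : ℕ) :
    (transfer φ ^ (s + l)) (coord l) = (transfer φ ^ s) (coord 0) := by
  rw [transfer_pow_add]
  have h := transfer_pow_comp_pastShift (φ := φ) (coord 0) l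
  simp only [coord_comp_iterate_pastShift, Nat.zero_add] at h
  exact congrArg _ h

theorem transfer_pow_coord_mul_coord (l d s : ℕ) :
    (transfer φ ^ (s + d + l)) (fun y => coord l y * coord (l + d) y) =
      (transfer φ ^ s) (fun y => coord 0 y * (transfer φ ^ d) (coord 0) y) := by
  rw [transfer_pow_add, transfer_pow_add]
  have h := transfer_pow_comp_pastShift (φ := φ) (fun y => coord 0 y * coord d y) l
  simp only [coord_comp_iterate_pastShift, Nat.zero_add, Nat.add_comm d l] at h
  rw [h]
  have h2 := transfer_pow_mul_comp_pastShift (φ := φ) (coord 0) (coord 0) d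
  simp only [coord_comp_iterate_pastShift, Nat.zero_add] at h2
  rw [h2]
  simp only [mul_comm]

/-- Given the past up to the older letter, the newer one has conditional mean `h`. Both `h` and its
average `c` lie between `h (-1)` and `h 1`, so multiplying `h - c` by a spin gives at most the
oscillation. -/
theorem covariance_coord_le (hφ : ∀ y, |φ y| ≤ 1) (hφm : Monotone φ) (l d t : ℕ)
    (ht : l + d ≤ t) :
    (transfer φ ^ t) (fun y => coord l y * coord (l + d) y) 1 -
        (transfer φ ^ t) (coord l) 1 * (transfer φ ^ t) (coord (l + d)) 1 ≤
      transferOsc φ (coord 0) d := by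
  obtain ⟨s, rfl⟩ : ∃ s, t = s + d + l := ⟨t - (l + d), by omega⟩
  have e1 : s + d + l = s + (l + d) := by omega
  rw [transfer_pow_coord_mul_coord, transfer_pow_coord l, e1, transfer_pow_coord (l + d),
    transfer_pow_add]
  set h := (transfer φ ^ d) (coord 0) with hh
  set c := (transfer φ ^ s) h 1 with hc
  have hm : Monotone h := monotone_transfer_pow hφ hφm (coord_mono 0) d
  have c1 : c ≤ h 1 := transfer_pow_one_antitone hφ hφm hm (Nat.zero_le s)
  have c2 : h (-1) ≤ c := by
    have := transfer_pow_mono hφ (f := fun _ => h (-1)) (g := h) (fun y => hm (minus_le y)) s 1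
    rwa [transfer_pow_const] at this
  have key : (fun y => coord 0 y * h y) ≤
      (c • coord 0 + fun _ => transferOsc φ (coord 0) d : (ℕ → ℤˣ) → ℝ) := by
    intro y
    have h1 := hm (le_plus y)
    have h2 := hm (minus_le y)
    have h3 := abs_coord 0 y
    have h4 : |coord 0 y * (h y - c)| ≤ transferOsc φ (coord 0) d := by
      rw [abs_mul, h3, one_mul, abs_le]
      simp only [transferOsc, ← hh]
      constructor <;> linarith
    have h5 := (abs_le.1 h4).2
    simp only [Pi.add_apply, Pi.smul_apply, smul_eq_mul]
    linarith
  have := transfer_pow_mono hφ key s 1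
  rw [map_add, map_smul, transfer_pow_const, Pi.add_apply, Pi.smul_apply, smul_eq_mul] at this
  linarith

theorem variance_sum_coord_le (hφ : ∀ y, |φ y| ≤ 1) (hφm : Monotone φ) {n t : ℕ} (hn : n ≤ t)
    {C : ℝ} (hC : ∑ d ∈ Finset.range n, transferOsc φ (coord 0) d ≤ C) :
    (transfer φ ^ t) (fun y => (∑ l ∈ Finset.range n, coord l y -
      ∑ l ∈ Finset.range n, (transfer φ ^ t) (coord l) 1) ^ 2) 1 ≤ 2 * n * C := by
  set e : ℕ → ℝ := fun l => (transfer φ ^ t) (coord l) 1 with he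
  set δ := transferOsc φ (coord 0) with hδ
  have h0 : ∀ i, 0 ≤ δ i := transferOsc_nonneg hφ hφm (coord_mono 0)
  set E : ((ℕ → ℤˣ) → ℝ) →ₗ[ℝ] ℝ := LinearMap.proj 1 ∘ₗ (transfer φ ^ t) with hE
  have hEe (l : ℕ) : E (coord l) = e l := rfl
  have hEc (c : ℝ) : E (fun _ => c) = c := by
    simp only [hE, LinearMap.comp_apply, transfer_pow_const, LinearMap.proj_apply]
  have hcov (l k : ℕ) : E (fun y => (coord l y - e l) * (coord k y - e k)) =
      E (fun y => coord l y * coord k y) - e l * e k := by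
    have : (fun y => (coord l y - e l) * (coord k y - e k)) =
        (fun y => coord l y * coord k y) - e k • coord l - e l • coord k + fun _ => e l * e k := by
      ext y
      simp only [Pi.add_apply, Pi.sub_apply, Pi.smul_apply, smul_eq_mul]
      ring
    rw [this, map_add, map_sub, map_sub, map_smul, map_smul, hEe, hEe, hEc, smul_eq_mul,
      smul_eq_mul]
    ring
  have hle (l d : ℕ) (h : l + d < n) :
      E (fun y => (coord l y - e l) * (coord (l + d) y - e (l + d))) ≤ δ d := by
    rw [hcov]; exact covariance_coord_le hφ hφm l d t (by omega)
  have hexp : (fun y => (∑ l ∈ Finset.range n, coord l y - ∑ l ∈ Finset.range n, e l) ^ 2) =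
      ∑ l ∈ Finset.range n, ∑ k ∈ Finset.range n,
        fun y => (coord l y - e l) * (coord k y - e k) := by
    ext y
    rw [← Finset.sum_sub_distrib, sq, Finset.sum_mul_sum]
    simp only [Finset.sum_apply]
  change E (fun y => (∑ l ∈ Finset.range n, coord l y - ∑ l ∈ Finset.range n, e l) ^ 2) ≤ _
  rw [hexp, map_sum]
  have hsub (r : ℕ) (hr : r ≤ n) : ∑ d ∈ Finset.range r, δ d ≤ C :=
    (Finset.sum_le_sum_of_subset_of_nonneg (Finset.range_mono hr) fun i _ _ => h0 i).trans hC
  have hrow (l : ℕ) (hl : l ∈ Finset.range n) :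
      E (∑ k ∈ Finset.range n, fun y => (coord l y - e l) * (coord k y - e k)) ≤ 2 * C := by
    rw [map_sum]
    have hl' := Finset.mem_range.1 hl
    obtain ⟨r, rfl⟩ := Nat.exists_eq_add_of_le hl'.le
    rw [Finset.sum_range_add]
    have a1 : ∑ k ∈ Finset.range l, E (fun y => (coord l y - e l) * (coord k y - e k)) ≤ C := by
      have : ∑ k ∈ Finset.range l, E (fun y => (coord l y - e l) * (coord k y - e k)) ≤
          ∑ k ∈ Finset.range l, δ (l - k) := by
        refine Finset.sum_le_sum fun k hk => ?_
        have hk' := Finset.mem_range.1 hk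
        have h := hle k (l - k) (by omega)
        rw [Nat.add_sub_cancel' hk'.le] at h
        simpa only [mul_comm] using h
      refine this.trans ?_
      -- The reflected term is `δ (k + 1)`, and `δ` is antitone.
      rw [← Finset.sum_range_reflect]
      refine le_trans (Finset.sum_le_sum (g := fun k => δ k) fun k hk => ?_)
        (hsub l (by omega))
      exact transferOsc_antitone hφ hφm (coord_mono 0)
        (by have := Finset.mem_range.1 hk; omega)
    have a2 : ∑ k ∈ Finset.range r,
        E (fun y => (coord l y - e l) * (coord (l + k) y - e (l + k))) ≤ C :=
      (Finset.sum_le_sum fun k hk => hle l k (by have := Finset.mem_range.1 hk; omega)).trans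
        (hsub r (by omega))
    linarith
  refine (Finset.sum_le_card_nsmul _ _ _ hrow).trans (le_of_eq ?_)
  rw [Finset.card_range, nsmul_eq_mul]; ring

/-- The indicator function that the sum of the last `n` letters is not positive. -/
noncomputable def nonposSum (n : ℕ) (y : ℕ → ℤˣ) : ℝ :=
  if ∑ l ∈ Finset.range n, (y l : ℤ) ≤ 0 then 1 else 0

theorem sum_units_mono {x y : ℕ → ℤˣ} (h : x ≤ y) (n : ℕ) :
    ∑ l ∈ Finset.range n, (x l : ℤ) ≤ ∑ l ∈ Finset.range n, (y l : ℤ) :=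
  Finset.sum_le_sum fun l _ => Units.val_le_val.2 (h l)

theorem nonposSum_antitone (n : ℕ) : Antitone (nonposSum n) := by
  intro x y h
  have := sum_units_mono h n
  unfold nonposSum
  split_ifs <;> first | exact le_rfl | exact zero_le_one | omega

/-- Chebyshev's inequality: the window sum has mean at least `n M` and variance at most `2 n C`. -/
theorem transfer_pow_nonposSum_le (hφ : ∀ y, |φ y| ≤ 1) (hφm : Monotone φ) {n : ℕ} {C M : ℝ}
    (hn : 0 < n) (hM : 0 < M) (hmean : ∀ t, M ≤ (transfer φ ^ t) (coord 0) 1)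
    (hC : ∑ d ∈ Finset.range n, transferOsc φ (coord 0) d ≤ C) (t : ℕ) :
    (transfer φ ^ t) (nonposSum n) 1 ≤ 2 * C / (n * M ^ 2) := by
  have hneg : Monotone (-nonposSum n) := (nonposSum_antitone n).neg
  -- The probability increases with time, so it may be bounded at time `t + n`, when the whole
  -- window has been produced by the chain.
  have h1 := transfer_pow_one_antitone hφ hφm hneg (Nat.le_add_right t n)
  simp only [map_neg, Pi.neg_apply, neg_le_neg_iff] at h1
  refine h1.trans ?_
  have hvar := variance_sum_coord_le hφ hφm (Nat.le_add_left n t) hC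
  set e := ∑ l ∈ Finset.range n, (transfer φ ^ (t + n)) (coord l) 1 with he
  have hn' : (0 : ℝ) < n := by exact_mod_cast hn
  have heM : n * M ≤ e := by
    have := Finset.card_nsmul_le_sum (Finset.range n)
      (fun l => (transfer φ ^ (t + n)) (coord l) 1) M fun l hl => by
        have hl' := Finset.mem_range.1 hl
        obtain ⟨s, hs⟩ : ∃ s, t + n = s + l := ⟨t + n - l, by omega⟩
        simp only [hs, transfer_pow_coord]
        exact hmean s
    rwa [Finset.card_range, nsmul_eq_mul] at this
  have hpos : 0 < n * M := by positivity
  have hmarkov : (fun y => (n * M) ^ 2 * nonposSum n y) ≤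
      fun y => (∑ l ∈ Finset.range n, coord l y - e) ^ 2 := by
    intro y
    simp only [nonposSum]
    split_ifs with h
    · have h' : ∑ l ∈ Finset.range n, coord l y ≤ 0 := by
        simp only [coord]; exact_mod_cast h
      nlinarith
    · rw [mul_zero]; positivity
  have h2 := (transfer_pow_mono hφ hmarkov (t + n) 1).trans hvar
  rw [transfer_pow_smul] at h2
  rw [le_div_iff₀ (by positivity)]
  have h3 : (n : ℝ) * ((transfer φ ^ (t + n)) (nonposSum n) 1 * (n * M ^ 2)) ≤ n * (2 * C) := by
    linarith
  exact le_of_mul_le_mul_left h3 hn'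

end Covariance

/-- If the tilt `φ` is below `ψ` by at most `κ` times the indicator of a nonpositive sum, then the
means of the current letter under the two chains, started from the maximal past, are close. -/
theorem transfer_pow_coord_sub_le {φ ψ : (ℕ → ℤˣ) → ℝ} (hφ : ∀ y, |φ y| ≤ 1)
    (hψ : ∀ y, |ψ y| ≤ 1) (hψm : Monotone ψ) {n : ℕ} {κ q : ℝ} (hκ : 0 ≤ κ)
    (hdiff : ∀ y, ψ y - φ y ≤ κ * nonposSum n y)
    (hq : ∀ t, (transfer φ ^ t) (nonposSum n) 1 ≤ q) (s t : ℕ) :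
    (transfer φ ^ s) ((transfer ψ ^ t) (coord 0)) 1 - (transfer φ ^ (s + t)) (coord 0) 1 ≤
      κ / 4 * q * ∑ i ∈ Finset.range t, transferOsc ψ (coord 0) i := by
  induction t generalizing s with
  | zero => simp
  | succ t ih =>
    -- Duhamel's formula: the steps of `ψ` are turned into steps of `φ` one at a time, hence the
    -- generalization over `s`.
    have h1 := ih (s + 1)
    have hosc := transferOsc_nonneg hψ hψm (coord_mono 0) t
    set h := (transfer ψ ^ t) (coord 0) with hh
    have hm : Monotone h := monotone_transfer_pow hψ hψm (coord_mono 0) t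
    have key : transfer ψ h ≤
        transfer φ h + fun y => κ / 4 * transferOsc ψ (coord 0) t * nonposSum n y := by
      intro y
      have a1 : h (prepend (-1) y) ≤ h (prepend 1 y) :=
        hm (prepend_mono (units_le_one _) le_rfl)
      have a2 : h (prepend 1 y) - h (prepend (-1) y) ≤ transferOsc ψ (coord 0) t := by
        have b1 := hm (le_plus (prepend 1 y))
        have b2 := hm (minus_le (prepend (-1) y))
        simp only [transferOsc, ← hh]; linarith
      have a3 : 0 ≤ κ * nonposSum n y := by
        refine mul_nonneg hκ ?_
        unfold nonposSum; split_ifs <;> norm_num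
      have a4 := mul_le_mul_of_nonneg_right (hdiff y) (sub_nonneg.2 a1)
      have a5 := mul_le_mul_of_nonneg_left a2 a3
      rw [Pi.add_apply, transfer_apply, transfer_apply]
      linarith
    have h2 := transfer_pow_mono hφ key s 1
    rw [map_add, Pi.add_apply, transfer_pow_smul, ← transfer_pow_succ', ← transfer_pow_succ] at h2
    have h3 : κ / 4 * transferOsc ψ (coord 0) t * (transfer φ ^ s) (nonposSum n) 1 ≤
        κ / 4 * transferOsc ψ (coord 0) t * q :=
      mul_le_mul_of_nonneg_left (hq s) (by positivity)
    rw [Finset.sum_range_succ]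
    have e : s + (t + 1) = s + 1 + t := by omega
    rw [e]
    linarith

/-! ### The majority tilts and the persistence of the magnetization -/

/-- The sign of the sum of the last `n` letters. -/
noncomputable def sgnSum (n : ℕ) (y : ℕ → ℤˣ) : ℝ :=
  ((SignType.sign (∑ l ∈ Finset.range n, (y l : ℤ)) : SignType) : ℝ)

theorem sgnSum_mono (n : ℕ) : Monotone (sgnSum n) := by
  intro x y h
  have h1 := (SignType.sign (α := ℤ)).monotone (sum_units_mono h n)
  unfold sgnSum
  revert h1
  generalize SignType.sign (∑ l ∈ Finset.range n, (x l : ℤ)) = a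
  generalize SignType.sign (∑ l ∈ Finset.range n, (y l : ℤ)) = b
  intro h1
  cases a <;> cases b <;> first | (exfalso; revert h1; decide) | norm_num

theorem sgnSum_neg (n : ℕ) (y : ℕ → ℤˣ) : sgnSum n (-y) = -sgnSum n y := by
  simp [sgnSum, Left.sign_neg]

theorem abs_sgnSum_le (n : ℕ) (y : ℕ → ℤˣ) : |sgnSum n y| ≤ 1 := by
  unfold sgnSum
  generalize SignType.sign (∑ l ∈ Finset.range n, (y l : ℤ)) = a
  cases a <;> norm_num

theorem one_sub_sgnSum_le (n : ℕ) (y : ℕ → ℤˣ) : 1 - sgnSum n y ≤ 2 * nonposSum n y := by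
  unfold nonposSum
  split_ifs with h
  · have := (abs_le.1 (abs_sgnSum_le n y)).1
    linarith
  · unfold sgnSum
    rw [sign_pos (not_le.1 h)]
    norm_num

theorem dependsOn_sgnSum {n m : ℕ} (h : n ≤ m) : DependsOn (sgnSum n) (Set.Iio m) := by
  intro x y hxy
  unfold sgnSum
  rw [Finset.sum_congr rfl fun l hl => ?_]
  rw [hxy l (lt_of_lt_of_le (Finset.mem_range.1 hl) h)]

/-- The tilt formed by the `K` first majorities, with geometric weights, and a constant bias. -/
noncomputable def majorityTilt (N : ℕ → ℕ) (K : ℕ) (b : ℝ) (y : ℕ → ℤˣ) : ℝ :=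
  ∑ j ∈ Finset.range K, 1 / 3 * (2 / 3 : ℝ) ^ j * sgnSum (N j) y + b

/-- The tilt formed by all majorities, with geometric weights. -/
noncomputable def fullTilt (N : ℕ → ℕ) (y : ℕ → ℤˣ) : ℝ :=
  ∑' j : ℕ, 1 / 3 * (2 / 3 : ℝ) ^ j * sgnSum (N j) y

section Tilt

variable {N : ℕ → ℕ}

theorem hasSum_weights : HasSum (fun j : ℕ => 1 / 3 * (2 / 3 : ℝ) ^ j) 1 := by
  have := (hasSum_geometric_of_lt_one (r := (2 / 3 : ℝ)) (by norm_num) (by norm_num)).mul_left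
    (1 / 3)
  norm_num at this ⊢
  exact this

theorem sum_range_weights (K : ℕ) :
    ∑ j ∈ Finset.range K, 1 / 3 * (2 / 3 : ℝ) ^ j = 1 - (2 / 3) ^ K := by
  induction K with
  | zero => simp
  | succ K ih => rw [Finset.sum_range_succ, ih, pow_succ]; ring

theorem abs_weight_mul_sgnSum_le (j : ℕ) (y : ℕ → ℤˣ) :
    |1 / 3 * (2 / 3 : ℝ) ^ j * sgnSum (N j) y| ≤ 1 / 3 * (2 / 3 : ℝ) ^ j := by
  rw [abs_mul, abs_of_nonneg (by positivity : (0 : ℝ) ≤ 1 / 3 * (2 / 3 : ℝ) ^ j)]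
  exact mul_le_of_le_one_right (by positivity) (abs_sgnSum_le _ _)

theorem summable_fullTilt (N : ℕ → ℕ) (y : ℕ → ℤˣ) :
    Summable fun j : ℕ => 1 / 3 * (2 / 3 : ℝ) ^ j * sgnSum (N j) y :=
  Summable.of_norm_bounded hasSum_weights.summable fun j => by
    rw [Real.norm_eq_abs]; exact abs_weight_mul_sgnSum_le j y

theorem abs_majorityTilt_le {K : ℕ} {b : ℝ} (hb0 : 0 ≤ b) (hb : b ≤ (2 / 3) ^ K)
    (y : ℕ → ℤˣ) : |majorityTilt N K b y| ≤ 1 := by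
  have h1 : |∑ j ∈ Finset.range K, 1 / 3 * (2 / 3 : ℝ) ^ j * sgnSum (N j) y| ≤ 1 - (2 / 3) ^ K := by
    rw [← sum_range_weights]
    exact (Finset.abs_sum_le_sum_abs _ _).trans
      (Finset.sum_le_sum fun j _ => abs_weight_mul_sgnSum_le j y)
  refine (abs_add_le _ _).trans ?_
  rw [abs_of_nonneg hb0]
  linarith

theorem majorityTilt_mono (K : ℕ) (b : ℝ) : Monotone (majorityTilt N K b) := by
  intro x y h
  unfold majorityTilt
  gcongr with j _
  exact sgnSum_mono _ h

theorem majorityTilt_zero_neg (K : ℕ) (y : ℕ → ℤˣ) :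
    majorityTilt N K 0 (-y) = -majorityTilt N K 0 y := by
  simp [majorityTilt, sgnSum_neg]

theorem dependsOn_majorityTilt {K m : ℕ} (b : ℝ) (h : ∀ j < K, N j ≤ m) :
    DependsOn (majorityTilt N K b) (Set.Iio m) := by
  intro x y hxy
  unfold majorityTilt
  rw [Finset.sum_congr rfl fun j hj => ?_]
  rw [dependsOn_sgnSum (h j (Finset.mem_range.1 hj)) hxy]

/-- The bias bounds the magnetization from below, as the majorities cannot lower it. -/
theorem half_bias_le_transfer_pow {K : ℕ} {b : ℝ} (hb0 : 0 ≤ b) (hb : b ≤ (2 / 3) ^ K) (t : ℕ) :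
    b / 2 ≤ (transfer (majorityTilt N K b) ^ t) (coord 0) 1 := by
  cases t with
  | zero =>
    have : (2 / 3 : ℝ) ^ K ≤ 1 := pow_le_one₀ (by norm_num) (by norm_num)
    rw [pow_zero, Module.End.one_apply, coord_one]
    linarith
  | succ t =>
    have h1 : transfer (majorityTilt N K b) (coord 0) =
        ∑ j ∈ Finset.range K, (1 / 2 * (1 / 3 * (2 / 3 : ℝ) ^ j)) • sgnSum (N j) +
          fun _ => b / 2 := by
      ext y
      rw [transfer_apply]
      simp only [coord, prepend, majorityTilt, Pi.add_apply, Finset.sum_apply, Pi.smul_apply,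
        smul_eq_mul, mul_assoc, ← Finset.mul_sum]
      push_cast
      ring
    have h2 (j : ℕ) : 0 ≤ (transfer (majorityTilt N K b) ^ t) (sgnSum (N j)) 1 := by
      -- Without bias the chain is odd and attractive, so every majority has nonnegative mean from
      -- the all-plus past; adding the bias only raises it.
      have hab0 := abs_majorityTilt_le (N := N) (K := K) (le_refl (0 : ℝ)) (by positivity)
      refine le_trans (transfer_pow_one_nonneg_of_odd hab0 (majorityTilt_mono K 0)
        (majorityTilt_zero_neg K) (sgnSum_mono (N j)) (sgnSum_neg (N j)) t) ?_
      exact transfer_pow_le_transfer_pow hab0 (abs_majorityTilt_le hb0 hb)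
        (majorityTilt_mono K b) (fun y => by unfold majorityTilt; linarith) (sgnSum_mono _) t 1
    rw [transfer_pow_succ', h1, map_add, map_sum, transfer_pow_const, Pi.add_apply,
      Finset.sum_apply]
    refine le_add_of_nonneg_left (Finset.sum_nonneg fun j _ => ?_)
    rw [map_smul, Pi.smul_apply, smul_eq_mul]
    exact mul_nonneg (by positivity) (h2 j)

/-- The cost of restoring one majority, uniformly in time. One factor `m 4^m` comes from the
variance of the window sum, the other from the sum of single-step errors. -/
theorem transfer_pow_majorityTilt_sub_le {K m : ℕ} (hm : 0 < m) (hN : ∀ j < K, N j ≤ m)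
    (hNK : 0 < N K) (t : ℕ) :
    (transfer (majorityTilt N K ((2 / 3) ^ K)) ^ t) (coord 0) 1 -
        (transfer (majorityTilt N (K + 1) ((2 / 3) ^ (K + 1))) ^ t) (coord 0) 1 ≤
      48 * (3 / 2 : ℝ) ^ K * (m ^ 2 * 16 ^ m) / N K := by
  set φ := majorityTilt N (K + 1) ((2 / 3) ^ (K + 1)) with hφ
  set ψ := majorityTilt N K ((2 / 3) ^ K) with hψ
  -- The pessimistic chain, majority `K` set to `-1`: its bias is `(2/3)^(K+1) - 1/3 (2/3)^K`. It
  -- lies below `φ` and has memory at most `m`.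
  set χ := majorityTilt N K (1 / 3 * (2 / 3) ^ K) with hχ
  have p : (0 : ℝ) < (2 / 3) ^ K := by positivity
  have hφb : ∀ y, |φ y| ≤ 1 := abs_majorityTilt_le (by positivity) le_rfl
  have hψb : ∀ y, |ψ y| ≤ 1 := abs_majorityTilt_le (by positivity) le_rfl
  have hχb : ∀ y, |χ y| ≤ 1 := abs_majorityTilt_le (by positivity) (by linarith)
  have hφe (y : ℕ → ℤˣ) : φ y = χ y + 1 / 3 * (2 / 3) ^ K * (1 + sgnSum (N K) y) := by
    simp only [hφ, hχ, majorityTilt, Finset.sum_range_succ, pow_succ]; ring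
  have hψe (y : ℕ → ℤˣ) : ψ y = χ y + 2 * (1 / 3 * (2 / 3) ^ K) := by
    simp only [hψ, hχ, majorityTilt]; ring
  have hχφ : χ ≤ φ := fun y => by
    have := (abs_le.1 (abs_sgnSum_le (N K) y)).1
    rw [hφe]
    exact le_add_of_nonneg_right (mul_nonneg (by positivity) (by linarith))
  have hosc {θ : (ℕ → ℤˣ) → ℝ} {b : ℝ} (hθ : θ = majorityTilt N K b) (hθb : ∀ y, |θ y| ≤ 1)
      (n : ℕ) : ∑ i ∈ Finset.range n, transferOsc θ (coord 0) i ≤ m * 4 ^ m * 2 := by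
    subst hθ
    have := sum_transferOsc_le hθb (majorityTilt_mono K b) (dependsOn_majorityTilt b hN)
      (coord_mono 0) (dependsOn_coord_zero hm) n
    rwa [transferOsc_coord_zero] at this
  have hq (s : ℕ) : (transfer φ ^ s) (nonposSum (N K)) 1 ≤
      2 * (m * 4 ^ m * 2) / (N K * (1 / 3 * (2 / 3) ^ K / 2) ^ 2) := by
    have h1 := transfer_pow_nonposSum_le hχb (majorityTilt_mono K _) hNK
      (by positivity : (0 : ℝ) < 1 / 3 * (2 / 3) ^ K / 2)
      (half_bias_le_transfer_pow (by positivity) (by linarith)) (hosc rfl hχb (N K)) s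
    have h2 := transfer_pow_le_transfer_pow hχb hφb (majorityTilt_mono _ _) hχφ
      (f := -nonposSum (N K)) (nonposSum_antitone (N K)).neg s 1
    simp only [map_neg, Pi.neg_apply, neg_le_neg_iff] at h2
    exact h2.trans h1
  have h := transfer_pow_coord_sub_le (κ := 2 / 3 * (2 / 3) ^ K) hφb hψb (majorityTilt_mono _ _)
    (by positivity) (fun y => by
      have := mul_le_mul_of_nonneg_left (one_sub_sgnSum_le (N K) y)
        (by positivity : (0 : ℝ) ≤ 1 / 3 * (2 / 3) ^ K)
      rw [hφe, hψe]; linarith) hq 0 t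
  rw [pow_zero, Module.End.one_apply, Nat.zero_add] at h
  refine h.trans ((mul_le_mul_of_nonneg_left (hosc hψ hψb t) (by positivity)).trans (le_of_eq ?_))
  have hN0 : (N K : ℝ) ≠ 0 := by exact_mod_cast hNK.ne'
  have e1 : (3 / 2 : ℝ) ^ K = ((2 / 3) ^ K)⁻¹ := by rw [← inv_pow]; norm_num
  have e2 : (16 : ℝ) ^ m = 4 ^ m * 4 ^ m := by rw [← mul_pow]; norm_num
  rw [e1, e2]
  field_simp
  ring

end Tilt

/-! ### Growth of the scales and passage to the limit -/

theorem sq_le_two_pow {m : ℕ} (hm : 4 ≤ m) : (m : ℝ) ^ 2 ≤ 2 ^ m := by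
  induction m, hm using Nat.le_induction with
  | base => norm_num
  | succ m hm ih =>
    have : (4 : ℝ) ≤ m := by exact_mod_cast hm
    rw [pow_succ 2 m]
    push_cast
    nlinarith

/-- Here `576 = (3/2) · 2 · 16 · 6 · 2`: the factor `2^m` absorbs `m^2`, `6^m ≥ 6^4` absorbs `48 ·
12`, and the last `2^m` supplies the summable decay. -/
theorem scale_ratio_le {K m : ℕ} {c : ℝ} (hm : 4 ≤ m) (hK : K ≤ m) (hc : 577 ≤ c) :
    48 * (3 / 2 : ℝ) ^ K * (m ^ 2 * 16 ^ m) / c ^ m ≤ 1 / 12 * (1 / 2) ^ K := by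
  have h1 : (3 / 2 : ℝ) ^ K ≤ (3 / 2) ^ m := pow_le_pow_right₀ (by norm_num) hK
  have h2 : (1 / 2 : ℝ) ^ m ≤ (1 / 2) ^ K := pow_le_pow_of_le_one (by norm_num) (by norm_num) hK
  have h3 : (6 : ℝ) ^ 4 ≤ 6 ^ m := pow_le_pow_right₀ (by norm_num) hm
  have h4 : (576 : ℝ) ^ m ≤ c ^ m := pow_le_pow_left₀ (by norm_num) (by linarith) m
  have e : (576 : ℝ) ^ m * (1 / 2) ^ m = (3 / 2) ^ m * 2 ^ m * 16 ^ m * 6 ^ m := by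
    rw [← mul_pow, ← mul_pow, ← mul_pow, ← mul_pow]; norm_num
  rw [div_le_iff₀ (lt_of_lt_of_le (by positivity) h4)]
  calc 48 * (3 / 2 : ℝ) ^ K * (m ^ 2 * 16 ^ m)
      ≤ 48 * (3 / 2 : ℝ) ^ m * (2 ^ m * 16 ^ m) := by gcongr; exact sq_le_two_pow hm
    _ ≤ 1 / 12 * 6 ^ m * ((3 / 2 : ℝ) ^ m * (2 ^ m * 16 ^ m)) := by
        rw [mul_assoc]; gcongr; norm_num at h3 ⊢; linarith
    _ = 1 / 12 * (1 / 2) ^ m * 576 ^ m := by linear_combination (-1 / 12) * e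
    _ ≤ 1 / 12 * (1 / 2) ^ K * c ^ m := by gcongr

section Limit

variable {N : ℕ → ℕ} {c : ℕ}

theorem scale_lower_bound (hN0 : 4 ≤ N 0) (hc : 2 ≤ c) (hN : ∀ j, N (j + 1) = c ^ N j)
    (j : ℕ) : j + 4 ≤ N j := by
  induction j with
  | zero => simpa using hN0
  | succ j ih =>
    have : N j < c ^ N j := Nat.lt_pow_self hc
    rw [hN]; omega

theorem transfer_pow_majorityTilt_ge (hN0 : 4 ≤ N 0) (hc : 577 ≤ c)
    (hN : ∀ j, N (j + 1) = c ^ N j) (K t : ℕ) :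
    1 / 12 + 1 / 12 * (1 / 2 : ℝ) ^ K ≤
      (transfer (majorityTilt N (K + 1) ((2 / 3) ^ (K + 1))) ^ t) (coord 0) 1 := by
  have hlow := scale_lower_bound hN0 (by omega : 2 ≤ c) hN
  have hmono : Monotone N := monotone_nat_of_le_succ fun j => by
    rw [hN]; exact (Nat.lt_pow_self (by omega)).le
  induction K with
  | zero =>
    -- Setting the first majority to `-1` leaves the bias `2/3 - 1/3 = 1/3`, hence a mean of at
    -- least `1/6 = 1/12 + 1/12`.
    have h1 := half_bias_le_transfer_pow (N := N) (K := 0) (b := 1 / 3) (by norm_num)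
      (by norm_num) t
    have h2 := transfer_pow_le_transfer_pow (ψ := majorityTilt N 0 (1 / 3))
      (φ := majorityTilt N 1 ((2 / 3) ^ 1))
      (abs_majorityTilt_le (by norm_num) (by norm_num))
      (abs_majorityTilt_le (by norm_num) (by norm_num)) (majorityTilt_mono _ _)
      (fun y => by
        have := (abs_le.1 (abs_sgnSum_le (N 0) y)).1
        simp only [majorityTilt, Finset.sum_range_zero, Finset.sum_range_one, pow_zero, pow_one]
        linarith) (coord_mono 0) t 1
    rw [Nat.zero_add, pow_zero]
    linarith
  | succ K ih =>
    have h1 := transfer_pow_majorityTilt_sub_le (N := N) (K := K + 1) (m := N K)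
      (by have := hlow K; omega) (fun j hj => hmono (Nat.lt_succ_iff.1 hj))
      (by have := hlow (K + 1); omega) t
    have h2 := scale_ratio_le (K := K + 1) (m := N K) (c := c) (by have := hlow K; omega)
      (by have := hlow K; omega) (by exact_mod_cast hc)
    rw [hN K, Nat.cast_pow] at h1
    have h3 : (1 / 2 : ℝ) ^ K = 2 * (1 / 2) ^ (K + 1) := by rw [pow_succ]; ring
    linarith

/-- For fixed `t`, the iterate at `y` is a finite expression in values of the tilt, so pointwise
convergence suffices. -/
theorem tendsto_transfer_pow {φ : ℕ → (ℕ → ℤˣ) → ℝ} {ψ : (ℕ → ℤˣ) → ℝ}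
    (h : ∀ y, Filter.Tendsto (fun K => φ K y) Filter.atTop (nhds (ψ y))) (f : (ℕ → ℤˣ) → ℝ)
    (t : ℕ) (y : ℕ → ℤˣ) :
    Filter.Tendsto (fun K => (transfer (φ K) ^ t) f y) Filter.atTop
      (nhds ((transfer ψ ^ t) f y)) := by
  induction t generalizing y with
  | zero => exact tendsto_const_nhds
  | succ t ih =>
    simp only [transfer_pow_succ, transfer_apply]
    exact (((h y).div_const 4).const_add _ |>.mul (ih _)).add
      (((h y).div_const 4).const_sub _ |>.mul (ih _))

theorem tendsto_majorityTilt (N : ℕ → ℕ) (y : ℕ → ℤˣ) :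
    Filter.Tendsto (fun K => majorityTilt N K ((2 / 3) ^ K) y) Filter.atTop
      (nhds (fullTilt N y)) := by
  have h1 := (summable_fullTilt N y).hasSum.tendsto_sum_nat
  have h2 := tendsto_pow_atTop_nhds_zero_of_lt_one (r := (2 / 3 : ℝ)) (by norm_num) (by norm_num)
  rw [← add_zero (fullTilt N y)]
  exact h1.add h2

theorem fullTilt_neg (y : ℕ → ℤˣ) : fullTilt N (-y) = -fullTilt N y := by
  simp only [fullTilt, sgnSum_neg, mul_neg, tsum_neg]

theorem transfer_pow_fullTilt_ge (hN0 : 4 ≤ N 0) (hc : 577 ≤ c)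
    (hN : ∀ j, N (j + 1) = c ^ N j) (t : ℕ) :
    1 / 12 ≤ (transfer (fullTilt N) ^ t) (coord 0) 1 := by
  refine ge_of_tendsto (tendsto_transfer_pow
    (fun y => (tendsto_majorityTilt N y).comp (Filter.tendsto_add_atTop_nat 1)) (coord 0) t 1)
    (Filter.Eventually.of_forall fun K => ?_)
  have h1 := transfer_pow_majorityTilt_ge hN0 hc hN K t
  have h2 : (0 : ℝ) ≤ 1 / 12 * (1 / 2) ^ K := by positivity
  exact le_trans (by linarith) h1

theorem transfer_pow_fullTilt_le (hN0 : 4 ≤ N 0) (hc : 577 ≤ c)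
    (hN : ∀ j, N (j + 1) = c ^ N j) (t : ℕ) :
    (transfer (fullTilt N) ^ t) (coord 0) (-1) ≤ -(1 / 12) := by
  rw [transfer_pow_odd fullTilt_neg (coord_neg 0), neg_le_neg_iff]
  exact transfer_pow_fullTilt_ge hN0 hc hN t

end Limit

/-! ### Existence of compatible measures -/

section GMeasure

open Filter Topology
open scoped BoundedContinuousFunction

theorem continuous_prepend {A : Type*} [TopologicalSpace A] (a : A) : Continuous (prepend a) :=
  continuous_pi fun n => by
    cases n with
    | zero => exact continuous_const
    | succ n => exact continuous_apply n

theorem measurable_prepend {A : Type*} [MeasurableSpace A] (a : A) : Measurable (prepend a) :=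
  measurable_pi_lambda _ fun n => by
    cases n with
    | zero => exact measurable_const
    | succ n => exact measurable_pi_apply n

theorem measurable_pastShift {A : Type*} [MeasurableSpace A] :
    Measurable (pastShift : (ℕ → A) → ℕ → A) :=
  measurable_pi_lambda _ fun n => measurable_pi_apply (n + 1)

variable {A : Type*} [Fintype A] [MeasurableSpace A]

/-- One step of the chain with transition probabilities `g`, acting on measures. -/
noncomputable def gStep (g : (ℕ → A) → ℝ) (μ : Measure (ℕ → A)) : Measure (ℕ → A) :=
  ∑ a : A, (μ.withDensity fun y => ENNReal.ofReal (g (prepend a y))).map (prepend a)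

/-- One step of the chain with transition probabilities `g`, acting on functions. -/
noncomputable def gOp (g f : (ℕ → A) → ℝ) (y : ℕ → A) : ℝ :=
  ∑ a : A, g (prepend a y) * f (prepend a y)

theorem gStep_apply (g : (ℕ → A) → ℝ) (μ : Measure (ℕ → A)) {S : Set (ℕ → A)}
    (hS : MeasurableSet S) :
    gStep g μ S =
      ∑ a : A, ∫⁻ y in prepend a ⁻¹' S, ENNReal.ofReal (g (prepend a y)) ∂μ := by
  rw [gStep, Measure.finsetSum_apply]
  refine Finset.sum_congr rfl fun a _ => ?_
  rw [Measure.map_apply (measurable_prepend a) hS,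
    withDensity_apply _ (measurable_prepend a hS)]

theorem gStep_preimage_pastShift {g : (ℕ → A) → ℝ} {μ : Measure (ℕ → A)}
    (hgm : ∀ a, Measurable fun y => g (prepend a y)) (hg0 : ∀ a y, 0 ≤ g (prepend a y))
    (hg1 : ∀ y, ∑ a, g (prepend a y) = 1) {S : Set (ℕ → A)} (hS : MeasurableSet S) :
    gStep g μ (pastShift ⁻¹' S) = μ S := by
  have h (a : A) : prepend a ⁻¹' (pastShift ⁻¹' S) = S := rfl
  rw [gStep_apply g μ (measurable_pastShift hS)]
  simp only [h]
  rw [← lintegral_finsetSum _ fun a _ => (hgm a).ennreal_ofReal]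
  simp only [← ENNReal.ofReal_sum_of_nonneg fun a (_ : a ∈ Finset.univ) => hg0 a _, hg1]
  simp

theorem isProbabilityMeasure_gStep {g : (ℕ → A) → ℝ} (μ : Measure (ℕ → A))
    [IsProbabilityMeasure μ]
    (hgm : ∀ a, Measurable fun y => g (prepend a y)) (hg0 : ∀ a y, 0 ≤ g (prepend a y))
    (hg1 : ∀ y, ∑ a, g (prepend a y) = 1) : IsProbabilityMeasure (gStep g μ) := by
  constructor
  have := gStep_preimage_pastShift (μ := μ) hgm hg0 hg1 MeasurableSet.univ
  rwa [Set.preimage_univ, measure_univ (μ := μ)] at this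

/-- Erasing the appended letter gives back the old law, so a fixed point of `gStep` is
shift-invariant. Evaluating it on `{x 0 = a} ∩ pastShift ⁻¹' S` gives the conditional probabilities.
-/
theorem isGMeasure_of_gStep_eq [MeasurableSingletonClass A] {g : (ℕ → A) → ℝ}
    {μ : Measure (ℕ → A)} [IsProbabilityMeasure μ]
    (hgm : ∀ a, Measurable fun y => g (prepend a y)) (hg0 : ∀ a y, 0 ≤ g (prepend a y))
    (hg1 : ∀ y, ∑ a, g (prepend a y) = 1) (hμ : gStep g μ = μ) : IsGMeasure g μ := by
  have hT : MeasurePreserving pastShift μ μ := by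
    refine ⟨measurable_pastShift, Measure.ext fun S hS => ?_⟩
    rw [Measure.map_apply measurable_pastShift hS]
    conv_lhs => rw [← hμ]
    exact gStep_preimage_pastShift hgm hg0 hg1 hS
  refine ⟨inferInstance, hT, fun a => ?_⟩
  have hle (a : A) (y : ℕ → A) : g (prepend a y) ≤ 1 := by
    rw [← hg1 y]
    exact Finset.single_le_sum (f := fun a => g (prepend a y)) (fun b _ => hg0 b y)
      (Finset.mem_univ a)
  have hgi : Integrable (fun y => g (prepend a y)) μ :=
    Integrable.of_bound (hgm a).aestronglyMeasurable 1 (Eventually.of_forall fun y => by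
      rw [Real.norm_eq_abs, abs_of_nonneg (hg0 a y)]; exact hle a y)
  have ha : MeasurableSet {x : ℕ → A | x 0 = a} :=
    (measurable_pi_apply 0 : Measurable fun x : ℕ → A => x 0) (measurableSet_singleton a)
  symm
  refine ae_eq_condExp_of_forall_setIntegral_eq measurable_pastShift.comap_le
    ((integrable_const 1).indicator ha) (fun s _ _ => ?_) (fun s hs _ => ?_) ?_
  · exact (hT.integrable_comp_of_integrable hgi).integrableOn
  · obtain ⟨S, hS, rfl⟩ := hs
    have hS' : MeasurableSet S := hS
    have h1 : ∫ x in pastShift ⁻¹' S, g (prepend a (pastShift x)) ∂μ =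
        ∫ y in S, g (prepend a y) ∂μ := by
      conv_rhs => rw [← hT.map_eq]
      rw [setIntegral_map hS' (hgm a).aestronglyMeasurable measurable_pastShift.aemeasurable]
    have h2 : μ ({x | x 0 = a} ∩ pastShift ⁻¹' S) =
        ∫⁻ y in S, ENNReal.ofReal (g (prepend a y)) ∂μ := by
      conv_lhs => rw [← hμ]
      rw [gStep_apply g μ (ha.inter (measurable_pastShift hS')),
        Finset.sum_eq_single a]
      · congr 2
        ext y
        simp [prepend, pastShift_prepend]
      · intro b _ hb
        have : prepend b ⁻¹' ({x | x 0 = a} ∩ pastShift ⁻¹' S) = ∅ := by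
          ext y
          simp [prepend, hb]
        rw [this]; simp
      · exact fun h => absurd (Finset.mem_univ a) h
    rw [h1, integral_indicator ha, Measure.restrict_restrict ha, integral_const, smul_eq_mul,
      mul_one, measureReal_def, Measure.restrict_apply_univ, h2,
      integral_eq_lintegral_of_nonneg_ae (Eventually.of_forall (hg0 a))
        (hgm a).aestronglyMeasurable]
  · exact ((hgm a).comp (comap_measurable pastShift)).aestronglyMeasurable

theorem continuous_gOp {A : Type*} [Fintype A] [TopologicalSpace A] {g f : (ℕ → A) → ℝ}
    (hg : ∀ a, Continuous fun y => g (prepend a y))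
    (hf : Continuous f) : Continuous (gOp g f) :=
  continuous_finsetSum _ fun a _ => (hg a).mul (hf.comp (continuous_prepend a))

variable [TopologicalSpace A] [DiscreteTopology A] [BorelSpace A]

theorem integral_gStep {g f : (ℕ → A) → ℝ} (μ : Measure (ℕ → A)) [IsProbabilityMeasure μ]
    (hg : ∀ a, Continuous fun y => g (prepend a y)) (hg0 : ∀ a y, 0 ≤ g (prepend a y))
    (hg1 : ∀ y, ∑ a, g (prepend a y) = 1) (hf : Continuous f) :
    ∫ x, f x ∂gStep g μ = ∫ y, gOp g f y ∂μ := by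
  have hgm (a : A) : Measurable fun y => g (prepend a y) := (hg a).measurable
  have hcont {μ : Measure (ℕ → A)} [IsFiniteMeasure μ] {f : (ℕ → A) → ℝ} (hf : Continuous f) :
      Integrable f μ := hf.integrable_of_hasCompactSupport (HasCompactSupport.of_compactSpace f)
  have := isProbabilityMeasure_gStep μ hgm hg0 hg1
  have hfi : Integrable f (gStep g μ) := hcont hf
  simp only [gStep] at hfi ⊢
  rw [integrable_finsetSum_measure] at hfi
  rw [integral_finsetSum_measure hfi]
  simp only [gOp]
  have hsum (a : A) : Integrable (fun y => g (prepend a y) * f (prepend a y)) μ :=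
    hcont ((hg a).mul (hf.comp (continuous_prepend a)))
  rw [integral_finsetSum _ fun a _ => hsum a]
  refine Finset.sum_congr rfl fun a _ => ?_
  rw [integral_map (measurable_prepend a).aemeasurable hf.measurable.aestronglyMeasurable,
    integral_withDensity_eq_integral_toReal_smul (hgm a).ennreal_ofReal
      (Eventually.of_forall fun y => ENNReal.ofReal_lt_top)]
  refine integral_congr_ae (Eventually.of_forall fun y => ?_)
  simp only [ENNReal.toReal_ofReal (hg0 a y), smul_eq_mul]

/-- Krylov–Bogoliubov: Cesàro averages of the laws started from `z` have a weak limit by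
compactness. Continuity of `g` makes `gOp g` preserve continuous test functions, so the limit is a
fixed point of `gStep`. -/
theorem exists_isGMeasure_le_integral {g : (ℕ → A) → ℝ}
    (hg : ∀ a, Continuous fun y => g (prepend a y)) (hg0 : ∀ a y, 0 ≤ g (prepend a y))
    (hg1 : ∀ y, ∑ a, g (prepend a y) = 1) {f : (ℕ → A) → ℝ} (hf : Continuous f) {δ : ℝ}
    (z : ℕ → A) (hδ : ∀ t, δ ≤ ((gOp g)^[t] f) z) :
    ∃ μ : Measure (ℕ → A), IsGMeasure g μ ∧ δ ≤ ∫ x, f x ∂μ := by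
  have hgm (a : A) : Measurable fun y => g (prepend a y) := (hg a).measurable
  have hcont {μ : Measure (ℕ → A)} [IsFiniteMeasure μ] {f : (ℕ → A) → ℝ} (hf : Continuous f) :
      Integrable f μ := hf.integrable_of_hasCompactSupport (HasCompactSupport.of_compactSpace f)
  set M : ℕ → Measure (ℕ → A) := fun t => (gStep g)^[t] (Measure.dirac z) with hM
  have hMsucc (t : ℕ) : M (t + 1) = gStep g (M t) := Function.iterate_succ_apply' _ _ _
  have hMp (t : ℕ) : IsProbabilityMeasure (M t) := by
    induction t with
    | zero => exact Measure.dirac.isProbabilityMeasure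
    | succ t ih => rw [hMsucc]; exact isProbabilityMeasure_gStep _ hgm hg0 hg1
  have hMi (t : ℕ) {f : (ℕ → A) → ℝ} (hf : Continuous f) :
      ∫ x, f x ∂M t = ((gOp g)^[t] f) z := by
    induction t generalizing f with
    | zero => exact integral_dirac f z
    | succ t ih =>
      rw [hMsucc, integral_gStep _ hg hg0 hg1 hf, ih (continuous_gOp hg hf),
        Function.iterate_succ_apply]
  set c : ℕ → ENNReal := fun n => ((n : ENNReal) + 1)⁻¹ with hc
  have hνp (n : ℕ) : IsProbabilityMeasure (c n • ∑ t ∈ Finset.range (n + 1), M t) := by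
    constructor
    rw [Measure.smul_apply, Measure.finsetSum_apply]
    simp only [measure_univ, Finset.sum_const, Finset.card_range, nsmul_eq_mul, mul_one,
      smul_eq_mul, hc]
    push_cast
    exact ENNReal.inv_mul_cancel (by simp) (by simp)
  have hνi (n : ℕ) {f : (ℕ → A) → ℝ} (hf : Continuous f) :
      ∫ x, f x ∂(c n • ∑ t ∈ Finset.range (n + 1), M t) =
        ((n : ℝ) + 1)⁻¹ * ∑ t ∈ Finset.range (n + 1), ∫ x, f x ∂M t := by
    rw [integral_smul_measure, integral_finsetSum_measure fun t _ => hcont hf, smul_eq_mul]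
    congr 1
    simp only [hc, ENNReal.toReal_inv]
    congr 1
  set ν : ℕ → ProbabilityMeasure (ℕ → A) := fun n => ⟨_, hνp n⟩ with hν
  set F : Ultrafilter (ProbabilityMeasure (ℕ → A)) := (hyperfilter ℕ).map ν with hF
  have hlim : Tendsto ν (hyperfilter ℕ) (𝓝 F.lim) := F.le_nhds_lim
  set μ := F.lim with hμ
  have hFint := ProbabilityMeasure.tendsto_iff_forall_integral_tendsto.1 hlim
  have hconv {f : (ℕ → A) → ℝ} (hf : Continuous f) :
      Tendsto (fun n : ℕ => ((n : ℝ) + 1)⁻¹ * ∑ t ∈ Finset.range (n + 1), ∫ x, f x ∂M t)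
        (hyperfilter ℕ) (𝓝 (∫ x, f x ∂(μ : Measure (ℕ → A)))) := by
    have h := hFint (BoundedContinuousFunction.mkOfCompact ⟨f, hf⟩)
    refine h.congr fun n => ?_
    exact hνi n hf
  refine ⟨μ, isGMeasure_of_gStep_eq hgm hg0 hg1 ?_, ?_⟩
  · have := isProbabilityMeasure_gStep (μ : Measure (ℕ → A)) hgm hg0 hg1
    refine ext_of_forall_integral_eq_of_IsFiniteMeasure fun f => ?_
    rw [integral_gStep _ hg hg0 hg1 f.continuous]
    have h1 := (hconv (continuous_gOp hg f.continuous)).sub (hconv f.continuous)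
    -- The two averages differ by a shift of time, so the sum telescopes to its end terms.
    have h2 (n : ℕ) : ((n : ℝ) + 1)⁻¹ * ∑ t ∈ Finset.range (n + 1), ∫ x, gOp g f x ∂M t -
        ((n : ℝ) + 1)⁻¹ * ∑ t ∈ Finset.range (n + 1), ∫ x, f x ∂M t =
        ((n : ℝ) + 1)⁻¹ * (∫ x, f x ∂M (n + 1) - ∫ x, f x ∂M 0) := by
      rw [← mul_sub, ← Finset.sum_sub_distrib, ← Finset.sum_range_sub fun t => ∫ x, f x ∂M t]
      congr 1
      refine Finset.sum_congr rfl fun t _ => ?_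
      rw [hMsucc, integral_gStep _ hg hg0 hg1 f.continuous]
    simp only [h2] at h1
    have hb (t : ℕ) : |∫ x, f x ∂M t| ≤ ‖f‖ := f.norm_integral_le_norm (M t)
    have h3 : Tendsto (fun n : ℕ => ((n : ℝ) + 1)⁻¹ * (∫ x, f x ∂M (n + 1) - ∫ x, f x ∂M 0))
        (hyperfilter ℕ) (𝓝 0) := by
      refine Tendsto.mono_left ?_ Nat.hyperfilter_le_atTop
      refine squeeze_zero_norm (a := fun n : ℕ => 1 / ((n : ℝ) + 1) * (2 * ‖f‖)) (fun n => ?_) ?_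
      · rw [norm_mul, Real.norm_eq_abs, Real.norm_eq_abs, one_div, abs_of_nonneg (by positivity)]
        have h4 := abs_sub (∫ x, f x ∂M (n + 1)) (∫ x, f x ∂M 0)
        have h5 := hb (n + 1)
        have h6 := hb 0
        gcongr
        linarith
      · simpa using (tendsto_one_div_add_atTop_nhds_zero_nat (𝕜 := ℝ)).mul_const (2 * ‖f‖)
    exact sub_eq_zero.1 (tendsto_nhds_unique h1 h3)
  · refine ge_of_tendsto (hconv hf) (Eventually.of_forall fun n => ?_)
    have h : ((n + 1 : ℕ) : ℝ) * δ ≤ ∑ t ∈ Finset.range (n + 1), ∫ x, f x ∂M t := by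
      have := Finset.card_nsmul_le_sum (Finset.range (n + 1)) (fun t => ∫ x, f x ∂M t) δ
        fun t _ => by rw [hMi t hf]; exact hδ t
      rwa [Finset.card_range, nsmul_eq_mul] at this
    rw [inv_mul_eq_div, le_div_iff₀ (by positivity)]
    push_cast at h
    linarith

end GMeasure

/-! ### The Bramson-Kalikow function -/

instance : MeasurableSingletonClass ℤˣ :=
  ⟨fun u => ⟨{(u : ℤ)}, measurableSet_singleton _, by ext v; simp [Units.ext_iff]⟩⟩

theorem continuous_sgnSum (n : ℕ) : Continuous (sgnSum n) := by
  have h1 : Continuous fun k : ℤ => ((SignType.sign k : SignType) : ℝ) :=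
    continuous_of_discreteTopology
  exact h1.comp (continuous_finsetSum _ fun l _ => Units.continuous_val.comp (continuous_apply l))

theorem continuous_fullTilt (N : ℕ → ℕ) : Continuous (fullTilt N) :=
  continuous_tsum (fun j => (continuous_sgnSum (N j)).const_mul _) hasSum_weights.summable
    fun j y => by rw [Real.norm_eq_abs]; exact abs_weight_mul_sgnSum_le j y

theorem abs_fullTilt_le (N : ℕ → ℕ) (y : ℕ → ℤˣ) : |fullTilt N y| ≤ 1 := by
  rw [← Real.norm_eq_abs, fullTilt]
  exact tsum_of_norm_bounded hasSum_weights fun j => by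
    rw [Real.norm_eq_abs]; exact abs_weight_mul_sgnSum_le j y

theorem continuous_coord (l : ℕ) : Continuous (coord l) :=
  (continuous_of_discreteTopology (f := fun k : ℤ => (k : ℝ))).comp
    (Units.continuous_val.comp (continuous_apply l))

theorem exists_sum_units_eq (n : ℕ) (y : ℕ → ℤˣ) :
    ∃ k : ℤ, ∑ l ∈ Finset.range n, (y l : ℤ) = n + 2 * k := by
  induction n with
  | zero => exact ⟨0, by simp⟩
  | succ n ih =>
    obtain ⟨k, hk⟩ := ih
    rw [Finset.sum_range_succ, hk]
    rcases Int.units_eq_one_or (y n) with h | h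
    · exact ⟨k, by rw [h]; push_cast; ring⟩
    · exact ⟨k - 1, by rw [h]; push_cast; ring⟩

/-- An odd window has no ties; at a tie the kernel would vanish for both letters. -/
theorem majorityKernel_prepend {n : ℕ} (hn : Odd n) (a : ℤˣ) (y : ℕ → ℤˣ) :
    majorityKernel (1 / 4) n (prepend a y) = 1 / 2 + ((a : ℤ) : ℝ) * sgnSum n y / 4 := by
  have h0 : ∑ l ∈ Finset.range n, (y l : ℤ) ≠ 0 := fun h => by
    obtain ⟨k, hk⟩ := exists_sum_units_eq n y
    obtain ⟨r, hr⟩ := hn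
    omega
  have h1 : ∑ l ∈ Finset.Icc 1 n, ((prepend a y l : ℤˣ) : ℤ) = ∑ l ∈ Finset.range n, (y l : ℤ) := by
    rw [Finset.range_eq_Ico]
    exact (Finset.sum_Ico_add' (fun l => ((prepend a y l : ℤˣ) : ℤ)) 0 n 1).symm
  unfold majorityKernel sgnSum
  rw [h1]
  change (if 0 < (a : ℤ) * _ then _ else _) + (if (a : ℤ) * _ < 0 then _ else _) = _
  generalize ∑ l ∈ Finset.range n, (y l : ℤ) = S at h0
  rcases Int.units_eq_one_or a with rfl | rfl <;> rcases lt_or_gt_of_ne h0 with h | h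
  · simp [h, h.not_gt]; norm_num
  · simp [h, h.not_gt]; norm_num
  · simp [h, h.not_gt]; norm_num
  · simp [h, h.not_gt]; norm_num

theorem bramsonKalikow_prepend {lam : ℕ → ℝ} {m : ℕ → ℕ}
    (hlam : ∀ j : ℕ, 1 ≤ j → lam j = (1 / 2 : ℝ) * (2 / 3 : ℝ) ^ j)
    (hm : ∀ j, Odd (m (j + 1))) (a : ℤˣ) (y : ℕ → ℤˣ) :
    bramsonKalikow (1 / 4) lam m (prepend a y) =
      1 / 2 + ((a : ℤ) : ℝ) * fullTilt (fun j => m (j + 1)) y / 4 := by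
  have h1 := (hasSum_weights.mul_right (1 / 2 : ℝ)).add
    ((summable_fullTilt (fun j => m (j + 1)) y).hasSum.mul_right (((a : ℤ) : ℝ) / 4))
  have h2 : (fun j : ℕ => lam (j + 1) * majorityKernel (1 / 4) (m (j + 1)) (prepend a y)) =
      fun j => 1 / 3 * (2 / 3 : ℝ) ^ j * (1 / 2) +
        1 / 3 * (2 / 3 : ℝ) ^ j * sgnSum (m (j + 1)) y * (((a : ℤ) : ℝ) / 4) := by
    ext j
    rw [majorityKernel_prepend (hm j), hlam (j + 1) (Nat.le_add_left 1 j), pow_succ]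
    ring
  rw [bramsonKalikow, h2, h1.tsum_eq]
  simp only [fullTilt]
  ring

theorem gOp_eq_transfer {g φ : (ℕ → ℤˣ) → ℝ}
    (h : ∀ a y, g (prepend a y) = 1 / 2 + ((a : ℤ) : ℝ) * φ y / 4) :
    gOp g = transfer φ := by
  ext f y
  have hu : (Finset.univ : Finset ℤˣ) = {1, -1} := rfl
  rw [gOp, hu, Finset.sum_pair (by decide), h, h, transfer_apply]
  push_cast
  ring

theorem corollary1 (lam : ℕ → ℝ) (m : ℕ → ℕ) (c : ℕ)
    (hlam : ∀ j : ℕ, 1 ≤ j → lam j = (1 / 2 : ℝ) * (2 / 3 : ℝ) ^ j)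
    (hc_odd : Odd c) (hc : 577 ≤ c)
    (hm_one : m 1 = 217) (hm : ∀ j : ℕ, 1 ≤ j → m (j + 1) = c ^ m j) :
    ∃ μ ν : Measure (ℕ → ℤˣ),
      IsGMeasure (bramsonKalikow (1 / 4) lam m) μ ∧
      IsGMeasure (bramsonKalikow (1 / 4) lam m) ν ∧
      μ ≠ ν := by
  set N : ℕ → ℕ := fun j => m (j + 1) with hN
  have hN0 : 4 ≤ N 0 := by simp only [hN, hm_one]; norm_num
  have hNs (j : ℕ) : N (j + 1) = c ^ N j := hm (j + 1) (Nat.le_add_left 1 j)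
  have hodd (j : ℕ) : Odd (m (j + 1)) := by
    cases j with
    | zero => rw [Nat.zero_add, hm_one]; decide
    | succ j => rw [hm (j + 1) (Nat.le_add_left 1 j)]; exact hc_odd.pow
  have hg := bramsonKalikow_prepend hlam hodd
  have hop := gOp_eq_transfer hg
  set g := bramsonKalikow (1 / 4) lam m
  have hgc (a : ℤˣ) : Continuous fun y => g (prepend a y) := by
    simp only [hg]
    exact (((continuous_fullTilt N).const_mul _).div_const 4).const_add _
  have hg0 (a : ℤˣ) (y : ℕ → ℤˣ) : 0 ≤ g (prepend a y) := by
    have h := abs_le.1 (abs_fullTilt_le N y)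
    rw [hg]
    rcases Int.units_eq_one_or a with rfl | rfl <;> push_cast <;> linarith
  have hg1 (y : ℕ → ℤˣ) : ∑ a, g (prepend a y) = 1 := by
    have h := congrFun (transfer_const (fullTilt N) 1) y
    rw [← hop] at h
    simpa only [gOp, mul_one] using h
  have hplus (t : ℕ) : 1 / 12 ≤ ((gOp g)^[t] (coord 0)) 1 := by
    rw [hop, ← Module.End.pow_apply]
    exact transfer_pow_fullTilt_ge hN0 hc hNs t
  have hminus (t : ℕ) : 1 / 12 ≤ ((gOp g)^[t] (-coord 0)) (-1) := by
    rw [hop, ← Module.End.pow_apply, map_neg, Pi.neg_apply, le_neg]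
    exact transfer_pow_fullTilt_le hN0 hc hNs t
  obtain ⟨μ, hμ, hμi⟩ := exists_isGMeasure_le_integral hgc hg0 hg1 (continuous_coord 0) 1 hplus
  obtain ⟨ν, hν, hνi⟩ :=
    exists_isGMeasure_le_integral hgc hg0 hg1 (continuous_coord 0).neg (-1) hminus
  refine ⟨μ, ν, hμ, hν, ?_⟩
  -- A common measure would give the current letter a mean both at least `1/12` and at most `-1/12`.
  rintro rfl
  simp only [Pi.neg_apply, integral_neg] at hνi
  linarith
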